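/- Let $S^1=\mathbb R/\mathbb Z$ and $\mathbb T^2=S^1\times S^1=\mathbb R^2/\mathbb Z^2$. Let $\alpha_1,\alpha_2\in\mathbb R\setminus\mathbb Q$, and let $I_1,I_2\subset S^1$ each be a finite union of closed intervals with nonempty interiors that is neither $\emptyset$ nor $S^1$. For $j=1,2$ let $r_{\alpha_j}(z)=z+\alpha_j$ on $S^1$, and let $(a_i)_{i\ge 0}$ and $(b_i)_{i\ge 0}$ be the itineraries of $0$ for $(\alpha_1,I_1)$ and $(\alpha_2,I_2)$: $a_i=1$ if $r_{\alpha_1}^i(0)\in I_1$ and $a_i=0$ otherwise; $b_i=1$ if $r_{\alpha_2}^i(0)\in I_2$ and $b_i=0$ otherwise. Write $\delta_{a_i,b_i}=1$ if $a_i=b_i$ and $0$ otherwise, let $I_j^c=S^1\setminus I_j$ and $B=(I_1\times I_2)\cup(I_1^c\times I_2^c)\subset\mathbb T^2$, and let $\overline{\mathcal O}$ be the closure in $\mathbb T^2$ of the orbit $\{(i\alpha_1,i\alpha_2):i\ge 0\}$ of $(0,0)$ under $r_{\alpha_1}\times r_{\alpha_2}$. Let $l$ denote length in $S^1$ (total length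 $1$) and Euclidean length in $\mathbb T^2$. Say that $1,\alpha_1,\alpha_2$ are rationally related if there are integers $p,q,s$, not all zero, with $p\alpha_1+q=s\alpha_2$. 1. If $1,\alpha_1,\alpha_2$ are not rationally related, then $$\lim_{n\to\infty}\frac1n\sum_{i=0}^{n-1}\delta_{a_i,b_i}=l(I_1)\,l(I_2)+l(I_1^c)\,l(I_2^c).$$ 2. If $1,\alpha_1,\alpha_2$ are rationally related, then $\overline{\mathcal O}$ is a union of finitely many circles, each the projection to $\mathbb T^2$ of a line of one and the same rational slope; and whenever $\overline{\mathcal O}$ is the union of exactly $k$ distinct such circles of slope $a/c$, with $a,c$ coprime integers and $c\neq 0$, the length $l(B\cap\overline{\mathcal O})$ is finite and $$\lim_{n\to\infty}\frac1n\sum_{i=0}^{n-1}\delta_{a_i,b_i}=\frac{l(B\cap\overline{\mathcal O})}{k\sqrt{a^2+c^2}}.$$ -/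

import Mathlib

open Filter Topology MeasureTheory

namespace CircleItinerary

noncomputable section

/-- The circle `S¹ = ℝ / ℤ`. -/
abbrev S1 : Type := UnitAddCircle

/-- The torus `𝕋² = S¹ × S¹`. -/
abbrev T2 : Type := S1 × S1

/-- The rotation `z ↦ z + α mod 1`. -/
def rotation (α : ℝ) (z : S1) : S1 := z + (α : S1)

/-- `I` is a finite union of closed intervals with nonempty interior in `S¹`, and `I` is neither
empty nor the whole circle. A closed interval of `S¹` is the image of some `[x, y]` with `x < y`. -/
def IsIntervalUnion (I : Set S1) : Prop :=
  I ≠ ∅ ∧ I ≠ Set.univ ∧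
    ∃ S : Finset (ℝ × ℝ), (∀ p ∈ S, p.1 < p.2) ∧
      I = ⋃ p ∈ S, (fun t : ℝ => (t : S1)) '' Set.Icc p.1 p.2

open Classical in
/-- The itinerary of `0` under the rotation by `α`, relative to `I`. -/
def itinerary (α : ℝ) (I : Set S1) (i : ℕ) : ℕ :=
  if (rotation α)^[i] 0 ∈ I then 1 else 0

/-- Total length of a subset of the circle (which has length `1`). -/
def circleLength (I : Set S1) : ℝ := volume.real I

/-- `1`, `α₁`, `α₂` are linearly dependent over the rationals. -/
def RationallyRelated (α₁ α₂ : ℝ) : Prop :=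
  ∃ a b c : ℤ, ¬(a = 0 ∧ b = 0 ∧ c = 0) ∧ (a : ℝ) * α₁ + b = c * α₂

/-- The translation `R = r_{α₁} × r_{α₂}` of the torus. -/
def torusRotation (α₁ α₂ : ℝ) : T2 → T2 := Prod.map (rotation α₁) (rotation α₂)

/-- The closure of the forward orbit of `(0, 0)` under the translation of the torus. -/
def orbitClosure (α₁ α₂ : ℝ) : Set T2 :=
  closure (Set.range fun i : ℕ => (torusRotation α₁ α₂)^[i] (0, 0))

/-- `B = (I₁ × I₂) ∪ (I₁ᶜ × I₂ᶜ)`. -/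
def agreeSet (I₁ I₂ : Set S1) : Set T2 := I₁ ×ˢ I₂ ∪ I₁ᶜ ×ˢ I₂ᶜ

/-- The projection to the torus of the line of slope `a / c` through (a lift of) `p`. -/
def slopeCircle (a c : ℤ) (p : T2) : Set T2 :=
  Set.range fun t : ℝ => p + (((t * c : ℝ) : S1), ((t * a : ℝ) : S1))

/-- `E` is the union of exactly `k` (distinct) circles of slope `a / c`, where the fraction `a / c`
is reduced. -/
def IsCircleUnion (E : Set T2) (k : ℕ) (a c : ℤ) : Prop :=
  c ≠ 0 ∧ IsCoprime a c ∧
    ∃ C : Finset (Set T2), C.card = k ∧ (∀ D ∈ C, ∃ p : T2, D = slopeCircle a c p) ∧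
      E = ⋃ D ∈ C, D

/-- Euclidean length in `𝕋² = ℝ² / ℤ²`: the one-dimensional Hausdorff measure for the flat metric
`√(d(x₁,y₁)² + d(x₂,y₂)²)` (the metric of `WithLp 2`; the bare product has the sup metric). -/
def torusLength (E : Set T2) : ENNReal :=
  μH[1] ((WithLp.toLp 2 : T2 → WithLp 2 T2) '' E)

/-- The fraction of indices `i < n` at which the sequences `u` and `v` agree. -/
def agreeFraction (u v : ℕ → ℕ) (n : ℕ) : ℝ :=
  (1 / (n : ℝ)) * ∑ i ∈ Finset.range n, if u i = v i then 1 else 0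

end

end CircleItinerary

open CircleItinerary

namespace CircleItinerary

/-! The itineraries agree at time `i` exactly when `i • x ∈ B`, where `x = (α₁, α₂)`, so the limit
is a visit frequency of a torus translation. By Weyl's criterion (`tendsto_orbitAverage`) the orbit
equidistributes for any invariant probability measure `μ` for which every character trivial at `x`
is trivial almost everywhere. Passing from continuous functions to `B` requires `μ (frontier B) =
0`: the frontier lies over finitely many points of one factor or the other, and the marginals of
`μ`, invariant under irrational rotations, have no atoms (`measure_singleton_of_invariant`).

It remains to choose `μ`. Without a rational relation only the trivial character is trivial at `x`,
and Haar measure works. With one, some multiple `g • x` lies on a closed one-parameter subgroup of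
rational slope, and finitely many translates of it fill the orbit closure
(`orbitClosure_eq_iUnion`). There `μ` is normalized length, and `IsCircleUnion.torusLength_eq`
supplies the denominator. -/

/-! ### Equidistribution of orbits of torus translations -/

/-- The character `y ↦ exp (2πi (m y₁ + n y₂))` of the torus. -/
noncomputable def torusChar (m n : ℤ) (y : T2) : ℂ :=
  (AddCircle.toCircle (m • y.1 + n • y.2) : ℂ)

lemma torusChar_add (m n : ℤ) (y z : T2) :
    torusChar m n (y + z) = torusChar m n y * torusChar m n z := by
  simp only [torusChar, Prod.fst_add, Prod.snd_add, smul_add]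
  rw [add_add_add_comm, AddCircle.toCircle_add, Circle.coe_mul]

lemma norm_torusChar (m n : ℤ) (y : T2) : ‖torusChar m n y‖ = 1 := Circle.norm_coe _

lemma torusChar_nsmul (m n : ℤ) (x : T2) (i : ℕ) :
    torusChar m n (i • x) = torusChar m n x ^ i := by
  induction i with
  | zero => simp [torusChar]
  | succ i ih => rw [succ_nsmul, torusChar_add, ih, pow_succ]

lemma torusChar_eq_one_iff (m n : ℤ) (y : T2) :
    torusChar m n y = 1 ↔ m • y.1 + n • y.2 = 0 := by
  rw [torusChar, Circle.coe_eq_one, ← AddCircle.toCircle_zero (T := (1 : ℝ))]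
  exact (AddCircle.injective_toCircle one_ne_zero).eq_iff

/-- The average of `f` over the first `n` points of the orbit of `0` under translation by `x`. -/
noncomputable def orbitAverage (x : T2) (f : T2 → ℂ) (n : ℕ) : ℂ :=
  (n : ℂ)⁻¹ * ∑ i ∈ Finset.range n, f (i • x)

lemma tendsto_geom_average {w : ℂ} (hw : ‖w‖ = 1) (h1 : w ≠ 1) :
    Tendsto (fun n : ℕ => (n : ℂ)⁻¹ * ∑ i ∈ Finset.range n, w ^ i) atTop (𝓝 0) := by
  have hb : ∀ n : ℕ, ‖(n : ℂ)⁻¹ * ∑ i ∈ Finset.range n, w ^ i‖ ≤ (n : ℝ)⁻¹ * (2 / ‖w - 1‖) := by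
    intro n
    rw [geom_sum_eq h1, norm_mul, norm_inv, norm_div, Complex.norm_natCast]
    gcongr
    calc ‖w ^ n - 1‖ ≤ ‖w ^ n‖ + ‖(1 : ℂ)‖ := norm_sub_le _ _
      _ = 2 := by rw [norm_pow, hw]; norm_num
  refine squeeze_zero_norm hb ?_
  simpa using (tendsto_inv_atTop_nhds_zero_nat (𝕜 := ℝ)).mul_const (2 / ‖w - 1‖)

/-- If the character is 1 at `x`, averages and integral are both 1. Otherwise the averages are those
of a bounded geometric sum, and invariance multiplies the integral by a factor other than 1, so it
vanishes. -/
lemma tendsto_orbitAverage_torusChar {x : T2} {μ : Measure T2} [IsProbabilityMeasure μ]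
    (hinv : MeasurePreserving (fun y => y + x) μ μ) (m n : ℤ)
    (hres : m • x.1 + n • x.2 = 0 → ∀ᵐ y ∂μ, m • y.1 + n • y.2 = 0) :
    Tendsto (orbitAverage x (torusChar m n)) atTop (𝓝 (∫ y, torusChar m n y ∂μ)) := by
  by_cases hx : torusChar m n x = 1
  · have hμ : ∫ y, torusChar m n y ∂μ = 1 := by
      have : torusChar m n =ᵐ[μ] fun _ => 1 :=
        (hres ((torusChar_eq_one_iff m n x).1 hx)).mono fun y hy =>
          (torusChar_eq_one_iff m n y).2 hy
      rw [integral_congr_ae this]; simp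
    rw [hμ]
    refine tendsto_const_nhds.congr' ?_
    filter_upwards [eventually_ne_atTop 0] with k hk
    have : (k : ℂ) ≠ 0 := by exact_mod_cast hk
    simp [orbitAverage, torusChar_nsmul, hx, this]
  · have hμ : ∫ y, torusChar m n y ∂μ = 0 := by
      have h1 : ∫ y, torusChar m n (y + x) ∂μ = ∫ y, torusChar m n y ∂μ :=
        hinv.integral_comp (MeasurableEquiv.addRight x).measurableEmbedding _
      simp only [torusChar_add, integral_mul_const] at h1
      have h2 : (∫ y, torusChar m n y ∂μ) * (torusChar m n x - 1) = 0 := by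
        rw [mul_sub, h1]; ring
      exact (mul_eq_zero.1 h2).resolve_right (sub_ne_zero.2 hx)
    rw [hμ]
    refine (tendsto_geom_average (norm_torusChar m n x) hx).congr fun k => ?_
    simp only [orbitAverage, torusChar_nsmul]

lemma norm_orbitAverage_le {x : T2} {f : T2 → ℂ} {C : ℝ} (hC : 0 ≤ C) (hf : ∀ y, ‖f y‖ ≤ C)
    (n : ℕ) : ‖orbitAverage x f n‖ ≤ C := by
  rcases eq_or_ne n 0 with rfl | hn
  · simpa [orbitAverage] using hC
  have hn' : (0 : ℝ) < n := by positivity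
  rw [orbitAverage, norm_mul, norm_inv, Complex.norm_natCast, inv_mul_le_iff₀ hn']
  calc ‖∑ i ∈ Finset.range n, f (i • x)‖ ≤ ∑ i ∈ Finset.range n, ‖f (i • x)‖ := norm_sum_le _ _
    _ ≤ ∑ _i ∈ Finset.range n, C := Finset.sum_le_sum fun i _ => hf _
    _ = n * C := by simp

lemma mFourier_finTwoArrow_symm (k : Fin 2 → ℤ) (y : T2) :
    UnitAddTorus.mFourier k (Homeomorph.finTwoArrow.symm y) = torusChar (k 0) (k 1) y := by
  simp [UnitAddTorus.mFourier, Fin.prod_univ_two, torusChar,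
    fourier_apply, AddCircle.toCircle_add]

/-- Weyl's criterion: the orbit of `0` is equidistributed for an invariant probability measure that
is concentrated on the annihilator of the characters that are trivial on the orbit. -/
lemma tendsto_orbitAverage {x : T2} {μ : Measure T2} [IsProbabilityMeasure μ]
    (hinv : MeasurePreserving (fun y => y + x) μ μ)
    (hres : ∀ m n : ℤ, m • x.1 + n • x.2 = 0 → ∀ᵐ y ∂μ, m • y.1 + n • y.2 = 0)
    (f : C(T2, ℂ)) : Tendsto (orbitAverage x f) atTop (𝓝 (∫ y, f y ∂μ)) := by
  have hint : ∀ g : C(T2, ℂ), Integrable g μ := fun g =>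
    g.continuous.integrable_of_hasCompactSupport (HasCompactSupport.of_compactSpace g)
  let e : C(T2, UnitAddTorus (Fin 2)) := ⟨Homeomorph.finTwoArrow.symm, Homeomorph.continuous _⟩
  have hspan : ∀ g ∈ Submodule.span ℂ (Set.range (UnitAddTorus.mFourier (d := Fin 2))),
      Tendsto (orbitAverage x (g.comp e)) atTop (𝓝 (∫ y, g.comp e y ∂μ)) := by
    intro g hg
    induction hg using Submodule.span_induction with
    | mem g hg =>
      obtain ⟨k, rfl⟩ := hg
      have : ⇑((UnitAddTorus.mFourier k).comp e) = torusChar (k 0) (k 1) :=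
        funext fun y => mFourier_finTwoArrow_symm k y
      rw [this]
      exact tendsto_orbitAverage_torusChar hinv _ _ (hres _ _)
    | zero =>
      have h0 : ∀ n, 0 = orbitAverage x 0 n := fun n => by simp [orbitAverage]
      simpa using tendsto_const_nhds.congr h0
    | add g₁ g₂ _ _ h₁ h₂ =>
      have := h₁.add h₂
      rw [← integral_add (hint _) (hint _)] at this
      refine this.congr fun n => ?_
      simp [orbitAverage, Finset.sum_add_distrib, mul_add]
    | smul c g _ h =>
      have := h.const_mul c
      rw [← integral_const_mul] at this
      refine this.congr fun n => ?_
      simp [orbitAverage, Finset.mul_sum, mul_left_comm]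
  rw [Metric.tendsto_atTop]
  intro ε hε
  -- Trigonometric polynomials are uniformly dense; replacing `f` by one costs `ε / 3` in the
  -- average and `ε / 3` in the integral.
  let F : C(UnitAddTorus (Fin 2), ℂ) := f.comp ⟨Homeomorph.finTwoArrow, Homeomorph.continuous _⟩
  have hF : F ∈ closure
      (Submodule.span ℂ (Set.range (UnitAddTorus.mFourier (d := Fin 2))) : Set _) := by
    rw [← Submodule.topologicalClosure_coe, UnitAddTorus.span_mFourier_closure_eq_top]
    trivial
  obtain ⟨g, hg, hgF⟩ := Metric.mem_closure_iff.1 hF (ε / 3) (by positivity)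
  have hfg : ∀ y, ‖f y - g.comp e y‖ ≤ ε / 3 := by
    intro y
    have h := (ContinuousMap.dist_apply_le_dist (f := F) (g := g) (e y)).trans hgF.le
    have h' : F (e y) = f y := congrArg f (Homeomorph.apply_symm_apply _ y)
    rwa [dist_eq_norm, h'] at h
  obtain ⟨N, hN⟩ := Metric.tendsto_atTop.1 (hspan g hg) (ε / 3) (by positivity)
  refine ⟨N, fun n hn => ?_⟩
  have h1 : ‖orbitAverage x f n - orbitAverage x (g.comp e) n‖ ≤ ε / 3 := by
    have : orbitAverage x f n - orbitAverage x (g.comp e) n =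
        orbitAverage x (fun y => f y - g.comp e y) n := by
      simp [orbitAverage, mul_sub]
    rw [this]
    exact norm_orbitAverage_le (by positivity) hfg n
  have h2 : ‖∫ y, g.comp e y ∂μ - ∫ y, f y ∂μ‖ ≤ ε / 3 := by
    rw [← integral_sub (hint _) (hint _)]
    refine (norm_integral_le_of_norm_le_const (C := ε / 3) (.of_forall fun y => ?_)).trans ?_
    · rw [norm_sub_rev]; exact hfg y
    · simp
  have h3 := hN n hn
  rw [dist_eq_norm] at h3 ⊢
  calc ‖orbitAverage x f n - ∫ y, f y ∂μ‖
      = ‖(orbitAverage x f n - orbitAverage x (g.comp e) n)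
          + (orbitAverage x (g.comp e) n - ∫ y, g.comp e y ∂μ)
          + (∫ y, g.comp e y ∂μ - ∫ y, f y ∂μ)‖ := by congr 1; ring
    _ ≤ _ := norm_add₃_le
    _ < ε := by linarith

/-- The uniform probability measure on the first `n + 1` points of the orbit of `0`. -/
noncomputable def empirical (x : T2) (n : ℕ) : ProbabilityMeasure T2 :=
  ⟨((n + 1 : ℕ) : ENNReal)⁻¹ • ∑ i ∈ Finset.range (n + 1), Measure.dirac (i • x), ⟨by
    simp only [Measure.smul_apply, Measure.finsetSum_apply, measure_univ, smul_eq_mul,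
      Finset.sum_const, Finset.card_range, nsmul_eq_mul, mul_one]
    exact ENNReal.inv_mul_cancel (by simp) (ENNReal.natCast_ne_top _)⟩⟩

lemma coe_empirical (x : T2) (n : ℕ) : (empirical x n : Measure T2) =
    ((n + 1 : ℕ) : ENNReal)⁻¹ • ∑ i ∈ Finset.range (n + 1), Measure.dirac (i • x) := rfl

lemma integral_empirical (x : T2) (n : ℕ) (f : T2 → ℂ) :
    ∫ y, f y ∂(empirical x n : Measure T2) = orbitAverage x f (n + 1) := by
  rw [coe_empirical, integral_smul_measure, integral_finsetSum_measure]
  · rw [ENNReal.toReal_inv, ENNReal.toReal_natCast, Complex.real_smul]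
    simp [orbitAverage, integral_dirac]
  · intro i _
    exact integrable_dirac (by simp)

-- Weyl's criterion is weak convergence of the empirical measures; the portmanteau theorem extends
-- it to sets with null frontier.
open Classical in
lemma tendsto_orbit_frequency {x : T2} {μ : Measure T2} [IsProbabilityMeasure μ]
    (hinv : MeasurePreserving (fun y => y + x) μ μ)
    (hres : ∀ m n : ℤ, m • x.1 + n • x.2 = 0 → ∀ᵐ y ∂μ, m • y.1 + n • y.2 = 0)
    {B : Set T2} (hB : MeasurableSet B) (hfr : μ (frontier B) = 0) :
    Tendsto (fun n : ℕ => (1 / (n : ℝ)) *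
      ∑ i ∈ Finset.range n, if i • x ∈ B then (1 : ℝ) else 0) atTop (𝓝 (μ.real B)) := by
  let ν : ProbabilityMeasure T2 := ⟨μ, inferInstance⟩
  have hweak : Tendsto (empirical x) atTop (𝓝 ν) := by
    rw [ProbabilityMeasure.tendsto_iff_forall_integral_rclike_tendsto ℂ]
    intro f
    simp only [integral_empirical]
    exact (tendsto_orbitAverage hinv hres f.toContinuousMap).comp (tendsto_add_atTop_nat 1)
  have h := ProbabilityMeasure.tendsto_measure_of_null_frontier_of_tendsto' hweak hfr
  have h' := (ENNReal.tendsto_toReal (measure_ne_top μ B)).comp h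
  -- `empirical x n` averages over `n + 1` points, hence the shift.
  rw [← tendsto_add_atTop_iff_nat 1]
  refine h'.congr fun n => ?_
  rw [Function.comp_apply, coe_empirical, Measure.smul_apply, Measure.finsetSum_apply, smul_eq_mul,
    ENNReal.toReal_mul, ENNReal.toReal_inv, ENNReal.toReal_natCast,
    ENNReal.toReal_sum fun i _ => measure_ne_top _ _, one_div]
  congr 1
  refine Finset.sum_congr rfl fun i _ => ?_
  rw [Measure.dirac_apply' _ hB, Set.indicator_apply]
  split_ifs <;> simp

/-! ### Boundaries and itineraries -/

lemma iterate_rotation (α : ℝ) (z : S1) (i : ℕ) :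
    (rotation α)^[i] z = z + i • (α : S1) := by
  induction i with
  | zero => simp
  | succ i ih => rw [Function.iterate_succ_apply', ih, rotation, succ_nsmul, add_assoc]

lemma iterate_torusRotation (α₁ α₂ : ℝ) (i : ℕ) :
    (torusRotation α₁ α₂)^[i] (0, 0) = i • ((α₁ : S1), (α₂ : S1)) := by
  rw [torusRotation, Prod.map_iterate]
  simp [iterate_rotation]

lemma itinerary_eq_iff (α₁ α₂ : ℝ) (I₁ I₂ : Set S1) (i : ℕ) :
    itinerary α₁ I₁ i = itinerary α₂ I₂ i ↔
      i • ((α₁ : S1), (α₂ : S1)) ∈ agreeSet I₁ I₂ := by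
  simp only [itinerary, agreeSet, Set.mem_union, Set.mem_prod,
    Set.mem_compl_iff, Prod.smul_fst, Prod.smul_snd]
  split_ifs <;> simp_all [iterate_rotation]

lemma IsIntervalUnion.isClosed {I : Set S1} (hI : IsIntervalUnion I) : IsClosed I := by
  obtain ⟨-, -, S, -, rfl⟩ := hI
  exact S.finite_toSet.isClosed_biUnion fun p _ =>
    (isCompact_Icc.image (AddCircle.continuous_mk' 1)).isClosed

/-- The quotient map is open, so images of open intervals are interior and only images of endpoints
can be frontier points. -/
lemma IsIntervalUnion.finite_frontier {I : Set S1} (hI : IsIntervalUnion I) :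
    (frontier I).Finite := by
  have hc := hI.isClosed
  obtain ⟨-, -, S, -, hS⟩ := hI
  refine (S.finite_toSet.biUnion fun p _ =>
    ((Set.toFinite {p.1, p.2}).image fun t : ℝ => (t : S1))).subset ?_
  intro z hz
  rw [hc.frontier_eq] at hz
  obtain ⟨hzI, hzi⟩ := hz
  have hzI' := hzI
  rw [hS] at hzI'
  simp only [Set.mem_iUnion] at hzI'
  obtain ⟨p, hp, t, ht, rfl⟩ := hzI'
  simp only [Set.mem_iUnion]
  refine ⟨p, hp, t, ?_, rfl⟩
  by_contra hne
  simp only [Set.mem_insert_iff, Set.mem_singleton_iff, not_or] at hne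
  refine hzi (mem_interior.2 ⟨(fun t : ℝ => (t : S1)) '' Set.Ioo p.1 p.2, ?_,
    QuotientAddGroup.isOpenMap_coe _ isOpen_Ioo,
    t, ⟨lt_of_le_of_ne ht.1 (Ne.symm hne.1), lt_of_le_of_ne ht.2 hne.2⟩, rfl⟩)
  rw [hS]
  exact (Set.image_mono Set.Ioo_subset_Icc_self).trans
    (Set.subset_biUnion_of_mem (u := fun p : ℝ × ℝ => (fun t : ℝ => (t : S1)) '' Set.Icc p.1 p.2)
      hp)

lemma measurableSet_agreeSet {I₁ I₂ : Set S1} (h₁ : MeasurableSet I₁) (h₂ : MeasurableSet I₂) :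
    MeasurableSet (agreeSet I₁ I₂) :=
  (h₁.prod h₂).union (h₁.compl.prod h₂.compl)

lemma frontier_agreeSet_subset (I₁ I₂ : Set S1) :
    frontier (agreeSet I₁ I₂) ⊆ Prod.fst ⁻¹' frontier I₁ ∪ Prod.snd ⁻¹' frontier I₂ := by
  intro y hy
  rcases frontier_union_subset _ _ hy with h | h
  · have := h.1
    rw [frontier_prod_eq] at this
    exact this.elim (fun h => .inr h.2) (fun h => .inl h.1)
  · have := h.2
    rw [frontier_prod_eq, frontier_compl, frontier_compl] at this
    exact this.elim (fun h => .inr h.2) (fun h => .inl h.1)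

lemma injective_nsmul_of_irrational {α : ℝ} (hα : Irrational α) :
    Function.Injective fun i : ℕ => i • (α : S1) := by
  refine injective_nsmul_iff_not_isOfFinAddOrder.2 fun h => ?_
  obtain ⟨n, hn, hn'⟩ := isOfFinAddOrder_iff_nsmul_eq_zero.1 h
  rw [← AddCircle.coe_nsmul, AddCircle.coe_eq_zero_iff] at hn'
  obtain ⟨m, hm⟩ := hn'
  refine (hα.natCast_mul hn.ne').ne_int m ?_
  simpa using hm.symm

/-- A finite measure on the circle invariant under an irrational rotation has no atoms. -/
lemma measure_singleton_of_invariant {ν : Measure S1} [IsFiniteMeasure ν] {α : ℝ}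
    (hα : Irrational α) (hinv : MeasurePreserving (fun z => z + (α : S1)) ν ν) (z : S1) :
    ν {z} = 0 := by
  by_contra h
  have hstep : ∀ w : S1, ν {w + (α : S1)} = ν {w} := fun w => by
    rw [← hinv.measure_preimage (measurableSet_singleton _).nullMeasurableSet]
    congr 1
    ext; simp
  have hall : ∀ i : ℕ, ν {z + i • (α : S1)} = ν {z} := by
    intro i
    induction i with
    | zero => simp
    | succ i ih => rw [succ_nsmul, ← add_assoc, hstep, ih]
  -- An atom would be repeated with equal mass along an infinite orbit, against finiteness of `ν`.
  have hinf : (Set.range fun i : ℕ => z + i • (α : S1)).Infinite :=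
    Set.infinite_range_of_injective
      ((add_right_injective z).comp (injective_nsmul_of_irrational hα))
  refine measure_ne_top ν _ (hinf.meas_eq_top ⟨ν {z}, h, ?_⟩)
  rintro _ ⟨i, rfl⟩
  exact (hall i).ge

/-- The first marginal is invariant under an irrational rotation, hence has no atoms. -/
lemma measure_finite_fst {μ : Measure T2} [IsFiniteMeasure μ] {x : T2} {α : ℝ}
    (hα : Irrational α) (hx : x.1 = α) (hinv : MeasurePreserving (fun y => y + x) μ μ)
    {F : Set S1} (hF : F.Finite) : μ (Prod.fst ⁻¹' F) = 0 := by
  have hi : MeasurePreserving (fun z => z + (α : S1)) (μ.map Prod.fst) (μ.map Prod.fst) := by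
    refine ⟨measurable_add_const _, ?_⟩
    rw [Measure.map_map (measurable_add_const _) measurable_fst]
    conv_rhs => rw [← hinv.map_eq, Measure.map_map measurable_fst hinv.measurable]
    congr 1
    ext y; simp [hx]
  rw [← Measure.map_apply measurable_fst hF.measurableSet, ← Set.biUnion_of_singleton F]
  exact (measure_biUnion_null_iff hF.countable).2 fun z _ => measure_singleton_of_invariant hα hi z

lemma measure_finite_snd {μ : Measure T2} [IsFiniteMeasure μ] {x : T2} {α : ℝ}
    (hα : Irrational α) (hx : x.2 = α) (hinv : MeasurePreserving (fun y => y + x) μ μ)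
    {F : Set S1} (hF : F.Finite) : μ (Prod.snd ⁻¹' F) = 0 := by
  have hi : MeasurePreserving (fun z => z + (α : S1)) (μ.map Prod.snd) (μ.map Prod.snd) := by
    refine ⟨measurable_add_const _, ?_⟩
    rw [Measure.map_map (measurable_add_const _) measurable_snd]
    conv_rhs => rw [← hinv.map_eq, Measure.map_map measurable_snd hinv.measurable]
    congr 1
    ext y; simp [hx]
  rw [← Measure.map_apply measurable_snd hF.measurableSet, ← Set.biUnion_of_singleton F]
  exact (measure_biUnion_null_iff hF.countable).2 fun z _ => measure_singleton_of_invariant hα hi z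

/-- The frequency of agreement of two itineraries is the measure of `agreeSet`, for the measure
that governs the distribution of the orbit. -/
lemma tendsto_agreeFraction {α₁ α₂ : ℝ} (h₁ : Irrational α₁) (h₂ : Irrational α₂)
    {I₁ I₂ : Set S1} (hI₁ : IsIntervalUnion I₁) (hI₂ : IsIntervalUnion I₂)
    {μ : Measure T2} [IsProbabilityMeasure μ]
    (hinv : MeasurePreserving (fun y => y + ((α₁ : S1), (α₂ : S1))) μ μ)
    (hres : ∀ m n : ℤ, m • (α₁ : S1) + n • (α₂ : S1) = 0 → ∀ᵐ y ∂μ, m • y.1 + n • y.2 = 0) :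
    Tendsto (agreeFraction (itinerary α₁ I₁) (itinerary α₂ I₂)) atTop
      (𝓝 (μ.real (agreeSet I₁ I₂))) := by
  have hfr : μ (frontier (agreeSet I₁ I₂)) = 0 :=
    measure_mono_null (frontier_agreeSet_subset I₁ I₂) (measure_union_null
      (measure_finite_fst h₁ rfl hinv hI₁.finite_frontier)
      (measure_finite_snd h₂ rfl hinv hI₂.finite_frontier))
  have h := tendsto_orbit_frequency hinv hres
    (measurableSet_agreeSet hI₁.isClosed.measurableSet hI₂.isClosed.measurableSet) hfr
  refine h.congr fun n => ?_
  rw [agreeFraction]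
  congr 1
  refine Finset.sum_congr rfl fun i _ => ?_
  by_cases hi : i • ((α₁ : S1), (α₂ : S1)) ∈ agreeSet I₁ I₂
  · rw [if_pos hi, if_pos ((itinerary_eq_iff α₁ α₂ I₁ I₂ i).2 hi)]
  · rw [if_neg hi, if_neg (mt (itinerary_eq_iff α₁ α₂ I₁ I₂ i).1 hi)]

lemma tendsto_agreeFraction_of_not_related {α₁ α₂ : ℝ} (h₁ : Irrational α₁) (h₂ : Irrational α₂)
    {I₁ I₂ : Set S1} (hI₁ : IsIntervalUnion I₁) (hI₂ : IsIntervalUnion I₂)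
    (hrel : ¬ RationallyRelated α₁ α₂) :
    Tendsto (agreeFraction (itinerary α₁ I₁) (itinerary α₂ I₂)) atTop
      (𝓝 (circleLength I₁ * circleLength I₂ + circleLength I₁ᶜ * circleLength I₂ᶜ)) := by
  have hm₁ := hI₁.isClosed.measurableSet
  have hm₂ := hI₂.isClosed.measurableSet
  have hμ : ((volume : Measure S1).prod (volume : Measure S1)).real (agreeSet I₁ I₂) =
      circleLength I₁ * circleLength I₂ + circleLength I₁ᶜ * circleLength I₂ᶜ := by
    rw [agreeSet, measureReal_union _ (hm₁.compl.prod hm₂.compl)]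
    · simp only [circleLength, measureReal_prod_prod]
    · exact Set.disjoint_left.2 fun y hy hy' => hy'.1 hy.1
  rw [← hμ]
  have : IsProbabilityMeasure (volume : Measure S1) := ⟨UnitAddCircle.measure_univ⟩
  refine tendsto_agreeFraction h₁ h₂ hI₁ hI₂ (measurePreserving_add_right _ _) ?_
  intro m n hmn
  -- A nontrivial character trivial at `(α₁, α₂)` would be a rational relation.
  have hz : m = 0 ∧ n = 0 := by
    by_contra hne
    rw [← AddCircle.coe_zsmul, ← AddCircle.coe_zsmul, ← AddCircle.coe_add,
      AddCircle.coe_eq_zero_iff] at hmn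
    obtain ⟨q, hq⟩ := hmn
    refine hrel ⟨m, -q, -n, by rw [neg_eq_zero, neg_eq_zero]; tauto, ?_⟩
    simp only [zsmul_eq_mul, mul_one] at hq
    push_cast
    linarith
  simp [hz.1, hz.2]

/-! ### Circles of rational slope and their length -/

/-- The one-parameter subgroup `t ↦ (t c, t a)` of the torus. -/
noncomputable def slopeHom (a c : ℤ) : ℝ →+ T2 where
  toFun t := (((t * c : ℝ) : S1), ((t * a : ℝ) : S1))
  map_zero' := by simp
  map_add' s t := by simp [add_mul]

lemma slopeHom_apply (a c : ℤ) (t : ℝ) :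
    slopeHom a c t = (((t * c : ℝ) : S1), ((t * a : ℝ) : S1)) := rfl

lemma continuous_slopeHom (a c : ℤ) : Continuous (slopeHom a c) := by
  have h (n : ℤ) : Continuous fun t : ℝ => ((t * n : ℝ) : S1) :=
    (AddCircle.continuous_mk' 1).comp (by fun_prop)
  exact (h c).prodMk (h a)

/-- By Bézout, `t` is an integer combination of `t * a` and `t * c`. Thus the subgroup is
parametrized injectively by `ℝ / ℤ`. -/
lemma slopeHom_eq_zero_iff {a c : ℤ} (hac : IsCoprime a c) (t : ℝ) :
    slopeHom a c t = 0 ↔ ∃ n : ℤ, (n : ℝ) = t := by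
  rw [slopeHom_apply, Prod.mk_eq_zero, AddCircle.coe_eq_zero_iff, AddCircle.coe_eq_zero_iff]
  simp only [zsmul_eq_mul, mul_one]
  constructor
  · rintro ⟨⟨m, hm⟩, ⟨n, hn⟩⟩
    obtain ⟨u, v, huv⟩ := hac
    have huv' : (u : ℝ) * a + v * c = 1 := by exact_mod_cast huv
    refine ⟨u * n + v * m, ?_⟩
    push_cast
    rw [hm, hn]
    linear_combination t * huv'
  · rintro ⟨n, rfl⟩
    exact ⟨⟨n * c, by push_cast; ring⟩, ⟨n * a, by push_cast; ring⟩⟩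

lemma mem_slopeCircle {a c : ℤ} {p y : T2} :
    y ∈ slopeCircle a c p ↔ ∃ t, p + slopeHom a c t = y := Iff.rfl

/-- Circles of one slope are cosets of one subgroup, so distinct ones are disjoint and their lengths
add. -/
lemma slopeCircle_eq_of_mem {a c : ℤ} {p y : T2} (hy : y ∈ slopeCircle a c p) :
    slopeCircle a c y = slopeCircle a c p := by
  obtain ⟨s, rfl⟩ := mem_slopeCircle.1 hy
  ext z
  rw [mem_slopeCircle, mem_slopeCircle]
  constructor
  · rintro ⟨t, rfl⟩
    exact ⟨s + t, by rw [map_add, add_assoc]⟩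
  · rintro ⟨t, rfl⟩
    exact ⟨t - s, by rw [map_sub]; abel⟩

lemma slopeCircle_eq_image {a c : ℤ} (hac : IsCoprime a c) (p : T2) :
    slopeCircle a c p = (fun t => p + slopeHom a c t) '' Set.Ico 0 1 := by
  ext y
  rw [mem_slopeCircle]
  constructor
  · rintro ⟨t, rfl⟩
    refine ⟨Int.fract t, ⟨Int.fract_nonneg t, Int.fract_lt_one t⟩, ?_⟩
    have : slopeHom a c ⌊t⌋ = 0 := (slopeHom_eq_zero_iff hac _).2 ⟨_, rfl⟩
    simp only [Int.fract, map_sub, this, sub_zero]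
  · rintro ⟨t, -, rfl⟩
    exact ⟨t, rfl⟩

lemma isClosed_slopeCircle {a c : ℤ} (hac : IsCoprime a c) (p : T2) :
    IsClosed (slopeCircle a c p) := by
  have : slopeCircle a c p = (fun t => p + slopeHom a c t) '' Set.Icc 0 1 := by
    refine Set.Subset.antisymm ?_ ?_
    · rw [slopeCircle_eq_image hac]
      exact Set.image_mono Set.Ico_subset_Icc_self
    · rintro _ ⟨t, -, rfl⟩
      exact ⟨t, rfl⟩
  rw [this]
  exact (isCompact_Icc.image (continuous_const.add (continuous_slopeHom a c))).isClosed

lemma injOn_slopeHom {a c : ℤ} (hac : IsCoprime a c) (p : T2) :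
    Set.InjOn (fun t => p + slopeHom a c t) (Set.Ico 0 1) := by
  intro s hs t ht hst
  have h0 : slopeHom a c (s - t) = 0 := by
    rw [map_sub, sub_eq_zero]; exact add_left_cancel hst
  obtain ⟨n, hn⟩ := (slopeHom_eq_zero_iff hac _).1 h0
  have h1 : (n : ℝ) < 1 := by rw [hn]; linarith [hs.2, ht.1]
  have h2 : (-1 : ℝ) < n := by rw [hn]; linarith [hs.1, ht.2]
  have hn0 : n = 0 := by
    have h1' : n < 1 := by exact_mod_cast h1
    have h2' : -1 < n := by exact_mod_cast h2
    omega
  rw [hn0, Int.cast_zero] at hn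
  linarith

/-- Length in the torus as a measure. -/
noncomputable def lengthMeasure : Measure T2 :=
  (μH[1] : Measure (WithLp 2 T2)).map WithLp.ofLp

lemma lengthMeasure_apply (E : Set T2) : lengthMeasure E = torusLength E := by
  have h : lengthMeasure E = (μH[1] : Measure (WithLp 2 T2)) (WithLp.ofLp ⁻¹' E) :=
    (MeasurableEquiv.toLp 2 T2).symm.map_apply E
  rw [h, torusLength]
  congr 1
  ext y
  exact ⟨fun hy => ⟨y.ofLp, hy, rfl⟩, by rintro ⟨z, hz, rfl⟩; exact hz⟩

lemma measurePreserving_lengthMeasure (x : T2) :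
    MeasurePreserving (fun y => y + x) lengthMeasure lengthMeasure := by
  refine ⟨measurable_add_const x, Measure.ext fun E hE => ?_⟩
  rw [Measure.map_apply (measurable_add_const x) hE, lengthMeasure_apply, lengthMeasure_apply,
    torusLength, torusLength,
    ← (IsometryEquiv.addRight (WithLp.toLp 2 x)).hausdorffMeasure_image 1]
  congr 1
  ext y
  constructor
  · rintro ⟨_, ⟨z, hz, rfl⟩, rfl⟩
    exact ⟨z + x, hz, rfl⟩
  · rintro ⟨z, hz, rfl⟩
    refine ⟨WithLp.toLp 2 (z - x), ⟨z - x, by simpa using hz, rfl⟩, ?_⟩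
    change WithLp.toLp 2 (z - x + x) = _
    rw [sub_add_cancel]

/-- Since `f` is isometric only on `S`, both `f '' S` and `S` are viewed as isometric images of the
subtype. -/
lemma hausdorffMeasure_image_of_dist_eq {Y : Type*} [MetricSpace Y] [MeasurableSpace Y]
    [BorelSpace Y] {f : ℝ → Y} {S : Set ℝ}
    (hf : ∀ s ∈ S, ∀ t ∈ S, dist (f s) (f t) = dist s t) : μH[1] (f '' S) = volume S := by
  have h1 : Isometry (fun s : S => f s) :=
    Isometry.of_dist_eq fun s t => hf s s.2 t t.2
  have h2 : Isometry (Subtype.val : S → ℝ) := isometry_subtype_coe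
  have e1 : f '' S = (fun s : S => f s) '' Set.univ := by
    rw [Set.image_univ, Set.image_eq_range]
  have e2 : S = Subtype.val '' (Set.univ : Set S) := by simp
  rw [e1, h1.hausdorffMeasure_image (Or.inl zero_le_one), ← hausdorffMeasure_real]
  conv_rhs => rw [e2, h2.hausdorffMeasure_image (Or.inl zero_le_one)]

/-- The norm on the circle is the absolute value up to `1 / 2`, and each coordinate displacement is
at most the Euclidean one. -/
lemma dist_slopeHom {a c : ℤ} (p : T2) {s t : ℝ}
    (h : |s - t| * √((a : ℝ) ^ 2 + (c : ℝ) ^ 2) ≤ 1 / 2) :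
    dist (WithLp.toLp 2 (p + slopeHom a c s)) (WithLp.toLp 2 (p + slopeHom a c t)) =
      |s - t| * √((a : ℝ) ^ 2 + (c : ℝ) ^ 2) := by
  have key : ∀ (n : ℤ) (q : S1), |(n : ℝ)| ≤ √((a : ℝ) ^ 2 + (c : ℝ) ^ 2) →
      dist (q + ((s * n : ℝ) : S1)) (q + ((t * n : ℝ) : S1)) = |s - t| * |(n : ℝ)| := by
    intro n q hn
    rw [dist_add_left, dist_eq_norm, ← AddCircle.coe_sub, ← sub_mul, ← abs_mul,
      AddCircle.norm_coe_eq_abs_iff _ one_ne_zero, abs_mul, abs_one]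
    exact (mul_le_mul_of_nonneg_left hn (abs_nonneg _)).trans h
  rw [WithLp.prod_dist_eq_of_L2]
  change √(dist (p.1 + ((s * c : ℝ) : S1)) (p.1 + ((t * c : ℝ) : S1)) ^ 2 +
    dist (p.2 + ((s * a : ℝ) : S1)) (p.2 + ((t * a : ℝ) : S1)) ^ 2) = _
  rw [key c _ (Real.abs_le_sqrt (by nlinarith [sq_nonneg (a : ℝ)])),
    key a _ (Real.abs_le_sqrt (by nlinarith [sq_nonneg (c : ℝ)]))]
  rw [← Real.sqrt_sq (abs_nonneg (s - t)), ← Real.sqrt_mul (sq_nonneg _),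
    Real.sqrt_sq (abs_nonneg (s - t))]
  congr 1
  rw [mul_pow, mul_pow, sq_abs (a : ℝ), sq_abs (c : ℝ)]
  ring

lemma torusLength_slopeHom_image_short {a c : ℤ} (p : T2) {u v : ℝ}
    (hl : 0 < √((a : ℝ) ^ 2 + (c : ℝ) ^ 2))
    (h : (v - u) * √((a : ℝ) ^ 2 + (c : ℝ) ^ 2) ≤ 1 / 2) :
    torusLength ((fun t => p + slopeHom a c t) '' Set.Ico u v) =
      ENNReal.ofReal ((v - u) * √((a : ℝ) ^ 2 + (c : ℝ) ^ 2)) := by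
  set l := √((a : ℝ) ^ 2 + (c : ℝ) ^ 2) with hl_def
  -- Reparametrization by arc length makes the curve isometric on the interval.
  have himg : (WithLp.toLp 2 : T2 → WithLp 2 T2) ''
      ((fun t => p + slopeHom a c t) '' Set.Ico u v) =
      (fun s => WithLp.toLp 2 (p + slopeHom a c (s / l))) '' Set.Ico (u * l) (v * l) := by
    rw [Set.image_image]
    ext y
    constructor
    · rintro ⟨t, ht, rfl⟩
      exact ⟨t * l, ⟨by nlinarith [ht.1], by nlinarith [ht.2]⟩, by simp [hl.ne']⟩
    · rintro ⟨s, hs, rfl⟩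
      exact ⟨s / l, ⟨(le_div_iff₀ hl).2 hs.1, (div_lt_iff₀ hl).2 hs.2⟩, rfl⟩
  rw [torusLength, himg, hausdorffMeasure_image_of_dist_eq, Real.volume_Ico, sub_mul]
  intro s hs t ht
  have hst : |s / l - t / l| * l = |s - t| := by
    rw [← sub_div, abs_div, abs_of_pos hl, div_mul_cancel₀ _ hl.ne']
  rw [dist_slopeHom p, ← hl_def, hst, Real.dist_eq]
  rw [← hl_def, hst, abs_le]
  constructor <;> nlinarith [hs.1, hs.2, ht.1, ht.2]

/-- The length of a circle of reduced slope `a / c`. -/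
lemma torusLength_slopeCircle {a c : ℤ} (hac : IsCoprime a c) (hc : c ≠ 0) (p : T2) :
    torusLength (slopeCircle a c p) = ENNReal.ofReal √((a : ℝ) ^ 2 + (c : ℝ) ^ 2) := by
  have hl : 0 < √((a : ℝ) ^ 2 + (c : ℝ) ^ 2) := by
    have : (c : ℝ) ≠ 0 := by exact_mod_cast hc
    positivity
  set l := √((a : ℝ) ^ 2 + (c : ℝ) ^ 2) with hl_def
  let γ : ℝ → T2 := fun t => p + slopeHom a c t
  have hγ : Continuous γ := continuous_const.add (continuous_slopeHom a c)
  -- With `N > 2 * l`, each of the `N` half-open arcs is shorter than `1 / 2`, so the local isometry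
  -- applies; the arcs are then added one at a time.
  obtain ⟨N, hN⟩ := exists_nat_gt (2 * l)
  have hN0 : (0 : ℝ) < N := by linarith
  have hstep : ∀ n : ℕ, n ≤ N →
      torusLength (γ '' Set.Ico 0 (n / N : ℝ)) = ENNReal.ofReal (n / N * l) := by
    intro n
    induction n with
    | zero => intro _; simp [torusLength]
    | succ n ih =>
      intro hn
      have hle : (((n + 1 : ℕ) : ℝ) / N) ≤ 1 := (div_le_one hN0).2 (by exact_mod_cast hn)
      have h1 : (n / N : ℝ) ≤ ((n + 1 : ℕ) : ℝ) / N := by gcongr; simp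
      have h0 : (0 : ℝ) ≤ n / N := by positivity
      have hs1 : Set.Ico (0 : ℝ) (n / N) ⊆ Set.Ico 0 1 :=
        Set.Ico_subset_Ico_right (h1.trans hle)
      have hs2 : Set.Ico (n / N : ℝ) (((n + 1 : ℕ) : ℝ) / N) ⊆ Set.Ico 0 1 :=
        Set.Ico_subset_Ico h0 hle
      have hmeas : MeasurableSet (γ '' Set.Ico (n / N : ℝ) (((n + 1 : ℕ) : ℝ) / N)) :=
        measurableSet_Ico.image_of_continuousOn_injOn hγ.continuousOn
          ((injOn_slopeHom hac p).mono hs2)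
      have hdisj : Disjoint (γ '' Set.Ico 0 (n / N : ℝ))
          (γ '' Set.Ico (n / N : ℝ) (((n + 1 : ℕ) : ℝ) / N)) :=
        Set.Ico_disjoint_Ico_same.image (injOn_slopeHom hac p) hs1 hs2
      have hdiff : ((n + 1 : ℕ) : ℝ) / N - n / N = 1 / N := by push_cast; ring
      have hshort := torusLength_slopeHom_image_short (a := a) (c := c) p hl
        (u := n / N) (v := ((n + 1 : ℕ) : ℝ) / N) (by
          rw [hdiff, one_div, inv_mul_le_iff₀ hN0]
          linarith)
      rw [← Set.Ico_union_Ico_eq_Ico h0 h1, Set.image_union, ← lengthMeasure_apply,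
        measure_union hdisj hmeas, lengthMeasure_apply, lengthMeasure_apply, ih (by omega), hshort,
        hdiff, ← ENNReal.ofReal_add (by positivity) (by positivity)]
      congr 1
      push_cast
      ring
  have := hstep N le_rfl
  rwa [div_self hN0.ne', one_mul, ← slopeCircle_eq_image hac] at this

/-- The length of a union of `k` circles of reduced slope `a / c`. -/
lemma IsCircleUnion.torusLength_eq {E : Set T2} {k : ℕ} {a c : ℤ} (h : IsCircleUnion E k a c) :
    torusLength E = ENNReal.ofReal (k * √((a : ℝ) ^ 2 + (c : ℝ) ^ 2)) := by
  obtain ⟨hc, hac, C, rfl, hC, rfl⟩ := h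
  rw [← lengthMeasure_apply, measure_biUnion_finset]
  · have : ∀ D ∈ C, lengthMeasure D = ENNReal.ofReal √((a : ℝ) ^ 2 + (c : ℝ) ^ 2) := by
      intro D hD
      obtain ⟨p, rfl⟩ := hC D hD
      rw [lengthMeasure_apply, torusLength_slopeCircle hac hc]
    rw [Finset.sum_congr rfl this, Finset.sum_const, nsmul_eq_mul,
      ENNReal.ofReal_mul (Nat.cast_nonneg _), ENNReal.ofReal_natCast]
  · intro D hD D' hD' hne
    obtain ⟨p, rfl⟩ := hC D hD
    obtain ⟨q, rfl⟩ := hC D' hD'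
    refine Set.disjoint_left.2 fun y hy hy' => hne ?_
    rw [← slopeCircle_eq_of_mem hy, ← slopeCircle_eq_of_mem hy']
  · intro D hD
    obtain ⟨p, rfl⟩ := hC D hD
    exact (isClosed_slopeCircle hac p).measurableSet

/-! ### The orbit closure in the rationally related case -/

lemma nsmul_mem_orbitClosure (α₁ α₂ : ℝ) (i : ℕ) :
    i • ((α₁ : S1), (α₂ : S1)) ∈ orbitClosure α₁ α₂ :=
  subset_closure ⟨i, iterate_torusRotation α₁ α₂ i⟩

lemma orbitClosure_subset {α₁ α₂ : ℝ} {K : Set T2} (hK : IsClosed K)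
    (h : ∀ i : ℕ, i • ((α₁ : S1), (α₂ : S1)) ∈ K) : orbitClosure α₁ α₂ ⊆ K := by
  refine closure_minimal ?_ hK
  rintro _ ⟨i, rfl⟩
  simpa only [iterate_torusRotation] using h i

lemma nsmul_add_mem_orbitClosure {α₁ α₂ : ℝ} (r : ℕ) {y : T2} (hy : y ∈ orbitClosure α₁ α₂) :
    r • ((α₁ : S1), (α₂ : S1)) + y ∈ orbitClosure α₁ α₂ := by
  refine orbitClosure_subset (K := (fun y => r • ((α₁ : S1), (α₂ : S1)) + y) ⁻¹'
    orbitClosure α₁ α₂) (isClosed_closure.preimage (continuous_const_add _)) (fun i => ?_) hy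
  rw [Set.mem_preimage, ← add_nsmul]
  exact nsmul_mem_orbitClosure α₁ α₂ _

/-- If the `g`-th multiple of `(α₁, α₂)` is an irrational point of the one-parameter subgroup of
slope `a / c`, the orbit closure is the union of `g` translates of that subgroup. -/
lemma orbitClosure_eq_iUnion {α₁ α₂ : ℝ} {a c : ℤ} (hac : IsCoprime a c) {g : ℕ} (hg : 0 < g)
    {t : ℝ} (ht : Irrational t) (hgt : g • ((α₁ : S1), (α₂ : S1)) = slopeHom a c t) :
    orbitClosure α₁ α₂ =
      ⋃ r ∈ Finset.range g, slopeCircle a c (r • ((α₁ : S1), (α₂ : S1))) := by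
  refine Set.Subset.antisymm (orbitClosure_subset ?_ fun i => ?_) ?_
  · exact (Finset.range g).finite_toSet.isClosed_biUnion fun r _ => isClosed_slopeCircle hac _
  · refine Set.mem_biUnion (x := i % g) (Finset.mem_coe.2 (Finset.mem_range.2 (Nat.mod_lt i hg))) ?_
    refine mem_slopeCircle.2 ⟨(i / g) • t, ?_⟩
    rw [map_nsmul, ← hgt, ← mul_nsmul, ← add_nsmul, Nat.mod_add_div]
  -- The multiples of `g • x` are the images of `i • t`, which are dense modulo 1 because `t` is
  -- irrational; in the compact circle nonnegative multiples suffice.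
  · have hsub : ∀ s : ℝ, slopeHom a c s ∈ orbitClosure α₁ α₂ := by
      have hd : DenseRange fun i : ℕ => i • (t : S1) := by
        have : DenseRange fun i : ℤ => i • (t : S1) := by
          exact AddCircle.denseRange_zsmul_coe_iff.2 (by simpa using ht)
        exact denseRange_zsmul_iff_nsmul.1 this
      have hd' : Dense ((fun s : ℝ => (s : S1)) ⁻¹' Set.range fun i : ℕ => i • (t : S1)) :=
        QuotientAddGroup.dense_preimage_mk.2 hd
      have hK : IsClosed (slopeHom a c ⁻¹' orbitClosure α₁ α₂) :=
        isClosed_closure.preimage (continuous_slopeHom a c)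
      have hle : ((fun s : ℝ => (s : S1)) ⁻¹' Set.range fun i : ℕ => i • (t : S1)) ⊆
          slopeHom a c ⁻¹' orbitClosure α₁ α₂ := by
        rintro s ⟨i, hi⟩
        have h0 : ((s - i • t : ℝ) : S1) = 0 := by
          rw [AddCircle.coe_sub, AddCircle.coe_nsmul, sub_eq_zero]; exact hi.symm
        rw [AddCircle.coe_eq_zero_iff] at h0
        obtain ⟨n, hn⟩ := h0
        have h1 : slopeHom a c (s - i • t) = 0 :=
          (slopeHom_eq_zero_iff hac _).2 ⟨n, by simpa using hn⟩
        rw [map_sub, map_nsmul, ← hgt, sub_eq_zero] at h1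
        rw [Set.mem_preimage, h1, ← mul_nsmul]
        exact nsmul_mem_orbitClosure α₁ α₂ _
      exact fun s => (hK.closure_subset_iff.2 hle) (hd' s)
    intro y hy
    simp only [Set.mem_iUnion] at hy
    obtain ⟨r, -, s, rfl⟩ := hy
    exact nsmul_add_mem_orbitClosure r (hsub s)

/-- Dividing `p` and `s` by their gcd `g` gives the slope `a / c`. A Bézout pair `u, v` then absorbs
`q`: the lift `(g α₁ + q u, g α₂ - q v)` of `g • x` lies on the line of that slope through the
origin. -/
lemma exists_isCircleUnion {α₁ α₂ : ℝ} (h₁ : Irrational α₁)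
    (hrel : RationallyRelated α₁ α₂) :
    ∃ (k : ℕ) (a c : ℤ), IsCircleUnion (orbitClosure α₁ α₂) k a c := by
  classical
  obtain ⟨p, q, s, hne, heq⟩ := hrel
  have hs : s ≠ 0 := by
    rintro rfl
    rcases eq_or_ne p 0 with rfl | hp
    · refine hne ⟨rfl, ?_, rfl⟩
      simpa using heq
    · refine (h₁.intCast_mul hp).ne_int (-q) ?_
      push_cast at heq ⊢
      linarith
  have hg : 0 < Int.gcd p s := Int.gcd_pos_of_ne_zero_right p hs
  obtain ⟨a, c, hcop, hp', hs'⟩ := Int.exists_gcd_one hg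
  set g := Int.gcd p s
  have hac : IsCoprime a c := Int.isCoprime_iff_gcd_eq_one.2 hcop
  have hc : c ≠ 0 := by rintro rfl; exact hs (by simpa using hs')
  have hcR : (c : ℝ) ≠ 0 := by exact_mod_cast hc
  obtain ⟨u, v, huv⟩ := id hac
  have huv' : (u : ℝ) * a + v * c = 1 := by exact_mod_cast huv
  have hpR : (p : ℝ) = a * g := by exact_mod_cast hp'
  have hsR : (s : ℝ) = c * g := by exact_mod_cast hs'
  rw [hpR, hsR] at heq
  let t : ℝ := (g * α₁ + (q * u : ℤ)) / c
  have ht : Irrational t := ((h₁.natCast_mul hg.ne').add_intCast _).div_intCast hc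
  have htc : t * c = g * α₁ + (q * u : ℤ) := div_mul_cancel₀ _ hcR
  have hta : t * a = g * α₂ + (-(q * v) : ℤ) := by
    have : t * a * c = (g * α₂ + (-(q * v) : ℤ)) * c := by
      rw [mul_right_comm, htc]
      push_cast
      linear_combination heq + q * huv'
    exact mul_right_cancel₀ hcR this
  have hint : ∀ n : ℤ, ((n : ℝ) : S1) = 0 := fun n =>
    (AddCircle.coe_eq_zero_iff 1).2 ⟨n, by simp⟩
  have hgt : g • ((α₁ : S1), (α₂ : S1)) = slopeHom a c t := by
    rw [slopeHom_apply, htc, hta, AddCircle.coe_add, AddCircle.coe_add, hint, hint, add_zero,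
      add_zero, ← nsmul_eq_mul, ← nsmul_eq_mul, AddCircle.coe_nsmul, AddCircle.coe_nsmul]
    rfl
  -- The `g` translates may coincide, so the number of circles is the cardinality of the image, not
  -- `g`.
  refine ⟨_, a, c, hc, hac,
    (Finset.range g).image fun r => slopeCircle a c (r • ((α₁ : S1), (α₂ : S1))), rfl, ?_, ?_⟩
  · intro D hD
    obtain ⟨r, -, rfl⟩ := Finset.mem_image.1 hD
    exact ⟨_, rfl⟩
  · rw [orbitClosure_eq_iUnion hac hg ht hgt, Finset.set_biUnion_finset_image]

/-- The circle description serves to show that the orbit closure has positive finite length, so that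
length restricted to it can be normalized. -/
lemma tendsto_agreeFraction_of_isCircleUnion {α₁ α₂ : ℝ} (h₁ : Irrational α₁)
    (h₂ : Irrational α₂) {I₁ I₂ : Set S1} (hI₁ : IsIntervalUnion I₁) (hI₂ : IsIntervalUnion I₂)
    {k : ℕ} {a c : ℤ} (hE : IsCircleUnion (orbitClosure α₁ α₂) k a c) :
    torusLength (agreeSet I₁ I₂ ∩ orbitClosure α₁ α₂) ≠ ⊤ ∧
    Tendsto (agreeFraction (itinerary α₁ I₁) (itinerary α₂ I₂)) atTop
      (𝓝 ((torusLength (agreeSet I₁ I₂ ∩ orbitClosure α₁ α₂)).toReal /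
        (k * √((a : ℝ) ^ 2 + (c : ℝ) ^ 2)))) := by
  set H := orbitClosure α₁ α₂ with hH_def
  set x : T2 := ((α₁ : S1), (α₂ : S1)) with hx
  have hHc : IsClosed H := isClosed_closure
  have hHm : MeasurableSet H := hHc.measurableSet
  have hlen : lengthMeasure H = ENNReal.ofReal (k * √((a : ℝ) ^ 2 + (c : ℝ) ^ 2)) := by
    rw [lengthMeasure_apply, hE.torusLength_eq]
  have hfin : lengthMeasure H ≠ ⊤ := by rw [hlen]; exact ENNReal.ofReal_ne_top
  have hpos : 0 < k * √((a : ℝ) ^ 2 + (c : ℝ) ^ 2) := by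
    obtain ⟨hc, -, C, hCk, -, hHC⟩ := hE
    have hcR : (c : ℝ) ≠ 0 := by exact_mod_cast hc
    have hk : 0 < k := by
      rw [← hCk, Finset.card_pos, Finset.nonempty_iff_ne_empty]
      rintro rfl
      have h0 : (0 : ℕ) • x ∈ H := nsmul_mem_orbitClosure α₁ α₂ 0
      rw [hHC] at h0
      simp at h0
    positivity
  have hlen0 : lengthMeasure H ≠ 0 := by
    rw [hlen]; exact (ENNReal.ofReal_pos.2 hpos).ne'
  refine ⟨?_, ?_⟩
  · rw [← lengthMeasure_apply]
    exact measure_ne_top_of_subset Set.inter_subset_right hfin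
  let μ : Measure T2 := (lengthMeasure H)⁻¹ • lengthMeasure.restrict H
  have : IsProbabilityMeasure μ := ⟨by
    rw [Measure.smul_apply, Measure.restrict_apply_univ, smul_eq_mul,
      ENNReal.inv_mul_cancel hlen0 hfin]⟩
  have hpres := measurePreserving_lengthMeasure x
  have hinv : MeasurePreserving (fun y => y + x) μ μ := by
    have h := (hpres.restrict_preimage hHm)
    -- Forward invariance is enough: `H` and its preimage have the same finite length, so the
    -- inclusion is an equality almost everywhere.
    have hsub : H ⊆ (fun y => y + x) ⁻¹' H := fun y hy => by
      have := nsmul_add_mem_orbitClosure 1 hy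
      rwa [one_nsmul, add_comm] at this
    have hae : H =ᵐ[lengthMeasure] (fun y => y + x) ⁻¹' H :=
      ae_eq_of_subset_of_measure_ge hsub
        (hpres.measure_preimage hHm.nullMeasurableSet).le hHm.nullMeasurableSet
        (by rwa [hpres.measure_preimage hHm.nullMeasurableSet])
    rw [← Measure.restrict_congr_set hae] at h
    exact h.smul_measure _
  have hres : ∀ m n : ℤ, m • (α₁ : S1) + n • (α₂ : S1) = 0 →
      ∀ᵐ y ∂μ, m • y.1 + n • y.2 = 0 := by
    intro m n hmn
    refine Measure.ae_smul_measure ?_ _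
    refine (ae_restrict_mem hHm).mono fun y hy => ?_
    have hcont : Continuous fun y : T2 => m • y.1 + n • y.2 := by fun_prop
    -- A character trivial at `x` is trivial on the orbit, hence on its closure.
    refine orbitClosure_subset (K := {y : T2 | m • y.1 + n • y.2 = 0})
      (isClosed_eq hcont continuous_const) (fun i => ?_) hy
    change m • (i • (α₁ : S1)) + n • (i • (α₂ : S1)) = 0
    rw [smul_comm m i, smul_comm n i, ← smul_add, hmn, smul_zero]
  have hB : MeasurableSet (agreeSet I₁ I₂) :=
    measurableSet_agreeSet hI₁.isClosed.measurableSet hI₂.isClosed.measurableSet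
  have hμB : μ.real (agreeSet I₁ I₂) = (torusLength (agreeSet I₁ I₂ ∩ H)).toReal /
      (k * √((a : ℝ) ^ 2 + (c : ℝ) ^ 2)) := by
    rw [measureReal_def, Measure.smul_apply, Measure.restrict_apply hB, lengthMeasure_apply (_ ∩ _),
      smul_eq_mul, ENNReal.toReal_mul, ENNReal.toReal_inv, hlen, ENNReal.toReal_ofReal hpos.le,
      div_eq_inv_mul]
  rw [← hμB]
  exact tendsto_agreeFraction h₁ h₂ hI₁ hI₂ hinv hres

end CircleItinerary

theorem mainTheorem4 (α₁ α₂ : ℝ) (h₁ : Irrational α₁) (h₂ : Irrational α₂)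
    (I₁ I₂ : Set S1) (hI₁ : IsIntervalUnion I₁) (hI₂ : IsIntervalUnion I₂) :
    (¬ RationallyRelated α₁ α₂ →
      Tendsto (agreeFraction (itinerary α₁ I₁) (itinerary α₂ I₂)) atTop
        (𝓝 (circleLength I₁ * circleLength I₂ + circleLength I₁ᶜ * circleLength I₂ᶜ))) ∧
    (RationallyRelated α₁ α₂ →
      (∃ (k : ℕ) (a c : ℤ), IsCircleUnion (orbitClosure α₁ α₂) k a c) ∧
      ∀ (k : ℕ) (a c : ℤ), IsCircleUnion (orbitClosure α₁ α₂) k a c →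
        torusLength (agreeSet I₁ I₂ ∩ orbitClosure α₁ α₂) ≠ ⊤ ∧
        Tendsto (agreeFraction (itinerary α₁ I₁) (itinerary α₂ I₂)) atTop
          (𝓝 ((torusLength (agreeSet I₁ I₂ ∩ orbitClosure α₁ α₂)).toReal /
            (k * √((a : ℝ) ^ 2 + (c : ℝ) ^ 2))))) := by
  exact ⟨tendsto_agreeFraction_of_not_related h₁ h₂ hI₁ hI₂, fun hrel =>
    ⟨exists_isCircleUnion h₁ hrel, fun _ _ _ hE =>
      tendsto_agreeFraction_of_isCircleUnion h₁ h₂ hI₁ hI₂ hE⟩⟩
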